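/- Let $d\ge 1$, $M\ge 2$ and $\gamma>0$. Let $\kappa_A,\kappa_U:(0,4]\to\mathbb R$ be functions whose limits at $0^+$ exist and are finite, extended to $0$ by these limits, and let $K_A(x,y)=\kappa_A(\|x-y\|^2)$ and $K_U(x,y)=\kappa_U(\|x-y\|^2)$ for $x,y\in\mathbb S^{d-1}=\{u\in\mathbb R^d:\|u\|_2=1\}$. For $M$-tuples $U=(u_1,\dots,u_M)$ and $V=(v_1,\dots,v_M)$ of points of $\mathbb S^{d-1}$ let $$L(U,V)=-\frac1M\sum_{i=1}^M K_A(u_i,v_i)+\frac{\gamma}{M(M-1)}\sum_{i\ne j}K_U(u_i,u_j),\qquad L_{\mathrm{sym}}(U,V)=\tfrac12\bigl(L(U,V)+L(V,U)\bigr).$$ (a) Let $1<M\le d+1$. Then there are $M$-tuples $U$ of points of $\mathbb S^{d-1}$ that form a regular $(M-1)$-simplex centred at the origin. If $\kappa_A$ is decreasing and $\kappa_U$ is decreasing and convex, then every pair $(U,V)$ such that $U=V$ and $U$ forms a regular $(M-1)$-simplex centred at the origin is a global minimiser of $L_{\mathrm{sym}}$ over $(\mathbb S^{d-1})^M\times(\mathbb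 S^{d-1})^M$. If $\kappa_A$ is strictly decreasing and $\kappa_U$ is strictly decreasing and strictly convex, then these pairs are the only global minimisers. (b) Let $M=2d$. Then there are $M$-tuples $U$ of points of $\mathbb S^{d-1}$ that form a cross-polytope, that is, that list without repetition the points $\pm e_1,\dots,\pm e_d$ for some orthonormal basis $e_1,\dots,e_d$ of $\mathbb R^d$. If $\kappa_A$ is decreasing and $\kappa_U$ is completely monotone on $(0,4]$ (derivatives of all orders exist, one-sided at $4$, and $(-1)^n\kappa_U^{(n)}\ge 0$ for all $n\ge 0$), then every pair $(U,V)$ such that $U=V$ and $U$ forms a cross-polytope is a global minimiser of $L_{\mathrm{sym}}$ over $(\mathbb S^{d-1})^M\times(\mathbb S^{d-1})^M$. Here "decreasing" means non-increasing; monotonicity and convexity are on $(0,4]$. -/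

import Mathlib

open Set Filter Topology
open scoped ContDiff

noncomputable section

namespace KCL

/-- The unit sphere `𝕊^{d-1}` of `ℝ^d` with its Euclidean norm. -/
abbrev UnitSphere (d : ℕ) : Type := Metric.sphere (0 : EuclideanSpace ℝ (Fin d)) 1

/-- The radial kernel `K(x, y) = κ(‖x - y‖²)` on the unit sphere of a function `κ : (0, 4] → ℝ`
whose limit at `0⁺` is `l`. The values of `κ` outside `(0, 4]` play no role: squared distances
on the unit sphere are at most `4`, and at coinciding points the kernel takes the value `l`. -/
def radialKernel {d : ℕ} (κ : ℝ → ℝ) (l : ℝ) (x y : UnitSphere d) : ℝ :=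
  open Classical in if x = y then l else κ (‖(x : EuclideanSpace ℝ (Fin d)) - y‖ ^ 2)

/-- The mini-batch kernel contrastive loss of a pair of `M`-tuples of points of the sphere. -/
def kcl {d M : ℕ} (KA KU : UnitSphere d → UnitSphere d → ℝ) (γ : ℝ)
    (U V : Fin M → UnitSphere d) : ℝ :=
  -(1 / (M : ℝ)) * ∑ i, KA (U i) (V i) +
    γ * (1 / ((M : ℝ) * ((M : ℝ) - 1))) * ∑ i, ∑ j ∈ Finset.univ.erase i, KU (U i) (U j)

/-- The symmetrised loss. -/
def kclSym {d M : ℕ} (KA KU : UnitSphere d → UnitSphere d → ℝ) (γ : ℝ)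
    (U V : Fin M → UnitSphere d) : ℝ :=
  1 / 2 * (kcl KA KU γ U V + kcl KA KU γ V U)

/-- The set of global minimisers of the symmetrised loss over pairs of `M`-tuples. -/
def kclArgmin {d M : ℕ} (KA KU : UnitSphere d → UnitSphere d → ℝ) (γ : ℝ) :
    Set ((Fin M → UnitSphere d) × (Fin M → UnitSphere d)) :=
  {p | IsMinOn (fun q : (Fin M → UnitSphere d) × (Fin M → UnitSphere d) =>
    kclSym KA KU γ q.1 q.2) univ p}

/-- The points `u₁, …, u_M` of the sphere are the vertices of a regular `(M-1)`-simplex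
centred at the origin: they are affinely independent, all edges have the same length,
and the barycentre is the origin. -/
def IsCenteredRegularSimplex {d M : ℕ} (U : Fin M → UnitSphere d) : Prop :=
  AffineIndependent ℝ (fun i => (U i : EuclideanSpace ℝ (Fin d))) ∧
  (∃ r : ℝ, ∀ i j, i ≠ j →
    dist (U i : EuclideanSpace ℝ (Fin d)) (U j : EuclideanSpace ℝ (Fin d)) = r) ∧
  ∑ i, (U i : EuclideanSpace ℝ (Fin d)) = 0

/-- The points `u₁, …, u_M` are, in some order and without repetition, the vertices
`e₁, …, e_d, -e₁, …, -e_d` of the cross-polytope of an orthonormal basis `e` of `ℝ^d`. -/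
def IsCrossPolytope {d M : ℕ} (U : Fin M → UnitSphere d) : Prop :=
  ∃ (e : OrthonormalBasis (Fin d) ℝ (EuclideanSpace ℝ (Fin d))) (σ : Fin d ⊕ Fin d ≃ Fin M),
    ∀ k, (U (σ (Sum.inl k)) : EuclideanSpace ℝ (Fin d)) = e k ∧
      (U (σ (Sum.inr k)) : EuclideanSpace ℝ (Fin d)) = -e k

/-- `f` is completely monotone on `s`: it has derivatives of all orders on `s` (relative to `s`,
hence one-sided at an endpoint of an interval) and `(-1)ⁿ f⁽ⁿ⁾ ≥ 0` on `s` for all `n ≥ 0`. -/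
def CompletelyMonotoneOn (f : ℝ → ℝ) (s : Set ℝ) : Prop :=
  ContDiffOn ℝ ∞ f s ∧ ∀ (n : ℕ), ∀ x ∈ s, 0 ≤ (-1) ^ n * iteratedDerivWithin n f s x

end KCL

end

/-! The two terms of the loss decouple. A decreasing alignment kernel is largest on the diagonal, so
`U = V` is optimal for the first term whatever `U` is, and only the pair energy of `κU` remains
(`mem_kclArgmin`, `eq_of_mem_kclArgmin`).

That energy is bounded by a linear programming argument: replace `κU` by a polynomial minorant in
the squared distance that agrees with it at the distances of the candidate configuration. The bound
extends to coinciding points by passing to the limit at `0`.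

For the simplex the minorant is a supporting line of slope `s ≤ 0` at `2M / (M - 1)`; its energy is
a constant plus `-2s‖∑ uᵢ‖²`, hence least when the barycentre is `0`. Under strict convexity,
equality forces every pair to that distance.

For the cross-polytope, whose squared distances are `2` and `4`, the minorant is a quadratic
touching at `2` and meeting at `4`. Its energy is a constant plus nonnegative multiples of `‖∑ uᵢ‖²`
and of the frame potential `∑ ⟪uᵢ, uⱼ⟫²`; the cross-polytope minimises both. -/

namespace KCL

/-! ### Polynomial minorants of functions on `(0, 4]` -/

section RealFunctions

variable {κ : ℝ → ℝ} {l : ℝ}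

lemma _root_.AntitoneOn.le_limit_zero (hκ : AntitoneOn κ (Ioc 0 4)) (hl : Tendsto κ (𝓝[>] 0) (𝓝 l))
    {t : ℝ} (ht : t ∈ Ioc (0 : ℝ) 4) : κ t ≤ l := by
  refine ge_of_tendsto hl ?_
  filter_upwards [Ioo_mem_nhdsGT ht.1] with x hx
  exact hκ ⟨hx.1, hx.2.le.trans ht.2⟩ ht hx.2.le

lemma _root_.StrictAntiOn.lt_limit_zero (hκ : StrictAntiOn κ (Ioc 0 4))
    (hl : Tendsto κ (𝓝[>] 0) (𝓝 l)) {t : ℝ} (ht : t ∈ Ioc (0 : ℝ) 4) : κ t < l := by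
  have ht' : t / 2 ∈ Ioc (0 : ℝ) 4 := ⟨by linarith [ht.1], by linarith [ht.1, ht.2]⟩
  exact (hκ ht' ht (by linarith [ht.1])).trans_le (hκ.antitoneOn.le_limit_zero hl ht')

/-- A pointwise lower bound passes to the limit at `0`. -/
lemma le_limit_zero_of_le {q : ℝ → ℝ} (hl : Tendsto κ (𝓝[>] 0) (𝓝 l)) (hq : ContinuousAt q 0)
    (h : ∀ t ∈ Ioc (0 : ℝ) 4, q t ≤ κ t) : q 0 ≤ l := by
  refine le_of_tendsto_of_tendsto (hq.tendsto.mono_left nhdsWithin_le_nhds) hl ?_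
  filter_upwards [Ioo_mem_nhdsGT (show (0 : ℝ) < 4 by norm_num)] with x hx
  exact h x ⟨hx.1, hx.2.le⟩

/-- A decreasing convex function on `(0, 4]` has a supporting line of nonpositive slope at every
point, the right endpoint included. -/
lemma exists_supporting_line (hκ : AntitoneOn κ (Ioc 0 4)) (hc : ConvexOn ℝ (Ioc 0 4) κ)
    {t₀ : ℝ} (ht₀ : t₀ ∈ Ioc (0 : ℝ) 4) :
    ∃ s ≤ 0, ∀ t ∈ Ioc (0 : ℝ) 4, κ t₀ + s * (t - t₀) ≤ κ t := by
  rcases ht₀.2.eq_or_lt with rfl | h4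
  -- At the endpoint `4` monotonicity alone gives a horizontal supporting line.
  · exact ⟨0, le_rfl, fun t ht => by simpa using hκ ht ht₀ ht.2⟩
  have hint : t₀ ∈ interior (Ioc (0 : ℝ) 4) := by
    rw [interior_Ioc]; exact ⟨ht₀.1, h4⟩
  have key : ∀ t ∈ Ioc (0 : ℝ) 4,
      κ t₀ + derivWithin κ (Ioi t₀) t₀ * (t - t₀) ≤ κ t := by
    intro t ht
    rcases lt_trichotomy t t₀ with h | rfl | h
    · have h1 := hc.slope_le_leftDeriv_of_mem_interior ht hint h
      have h2 := h1.trans (hc.leftDeriv_le_rightDeriv_of_mem_interior hint)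
      rw [slope_def_field, div_le_iff₀ (by linarith)] at h2
      linarith
    · simp
    · have h1 := hc.rightDeriv_le_slope_of_mem_interior hint ht h
      rw [slope_def_field, le_div_iff₀ (by linarith)] at h1
      linarith
  refine ⟨_, ?_, key⟩
  have h1 := key 4 ⟨by norm_num, le_rfl⟩
  have h2 := hκ ht₀ (⟨by norm_num, le_rfl⟩ : (4 : ℝ) ∈ Ioc (0 : ℝ) 4) ht₀.2
  by_contra! h
  nlinarith [mul_pos h (sub_pos.2 h4)]

lemma supporting_line_lt (hc : StrictConvexOn ℝ (Ioc 0 4) κ) {t₀ s : ℝ}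
    (ht₀ : t₀ ∈ Ioc (0 : ℝ) 4) (hs : ∀ t ∈ Ioc (0 : ℝ) 4, κ t₀ + s * (t - t₀) ≤ κ t)
    {t : ℝ} (ht : t ∈ Ioc (0 : ℝ) 4) (hne : t ≠ t₀) : κ t₀ + s * (t - t₀) < κ t := by
  have h1 := hc.2 ht ht₀ hne (show (0 : ℝ) < 1 / 2 by norm_num)
    (show (0 : ℝ) < 1 / 2 by norm_num) (by norm_num)
  have h2 := hs (1 / 2 * t + 1 / 2 * t₀)
    ⟨by linarith [ht.1, ht₀.1], by linarith [ht.2, ht₀.2]⟩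
  simp only [smul_eq_mul] at h1
  linarith

/-- Strictness could be lost in the limit. The supporting line at `t₀ / 2` prevents this: it is
strictly above the given line at `t₀ / 2` and not above it at `t₀`, hence strictly above it at `0`,
where its value is at most `l`. -/
lemma supporting_line_lt_limit (hκ : AntitoneOn κ (Ioc 0 4))
    (hc : StrictConvexOn ℝ (Ioc 0 4) κ) (hl : Tendsto κ (𝓝[>] 0) (𝓝 l)) {t₀ s : ℝ}
    (ht₀ : t₀ ∈ Ioc (0 : ℝ) 4) (hs : ∀ t ∈ Ioc (0 : ℝ) 4, κ t₀ + s * (t - t₀) ≤ κ t) :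
    κ t₀ + s * (0 - t₀) < l := by
  have hm : t₀ / 2 ∈ Ioc (0 : ℝ) 4 := ⟨by linarith [ht₀.1], by linarith [ht₀.1, ht₀.2]⟩
  obtain ⟨s', -, hs'⟩ := exists_supporting_line hκ hc.convexOn hm
  have h0 := le_limit_zero_of_le (q := fun t => κ (t₀ / 2) + s' * (t - t₀ / 2)) hl
    (by fun_prop) hs'
  have h1 := hs' t₀ ht₀
  have h2 := supporting_line_lt hc ht₀ hs hm (by linarith [ht₀.1])
  linarith

/-- If `f` has nonnegative second and nonpositive third derivative, it lies above the quadratic that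
touches it at `2` and meets it at `4`, whose leading coefficient is nonnegative. -/
lemma exists_quadratic_minorant {f f₁ f₂ f₃ : ℝ → ℝ} (hf : ContinuousOn f (Ioc 0 4))
    (h₁ : ∀ x ∈ Ioo (0 : ℝ) 4, HasDerivAt f (f₁ x) x)
    (h₂ : ∀ x ∈ Ioo (0 : ℝ) 4, HasDerivAt f₁ (f₂ x) x)
    (h₃ : ∀ x ∈ Ioo (0 : ℝ) 4, HasDerivAt f₂ (f₃ x) x)
    (hf₂ : ∀ x ∈ Ioo (0 : ℝ) 4, 0 ≤ f₂ x) (hf₃ : ∀ x ∈ Ioo (0 : ℝ) 4, f₃ x ≤ 0) :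
    ∃ c, 0 ≤ c ∧ f 2 + f₁ 2 * (4 - 2) + c * (4 - 2) ^ 2 = f 4 ∧
      ∀ t ∈ Ioc (0 : ℝ) 4, f 2 + f₁ 2 * (t - 2) + c * (t - 2) ^ 2 ≤ f t := by
  have hmem2 : (2 : ℝ) ∈ Ioo (0 : ℝ) 4 := by constructor <;> norm_num
  have hf₁c : ContinuousOn f₁ (Ioo 0 4) := fun x hx => (h₂ x hx).continuousAt.continuousWithinAt
  have hmono : MonotoneOn f₁ (Ioo 0 4) := by
    refine monotoneOn_of_deriv_nonneg (convex_Ioo _ _) hf₁c ?_ ?_ <;> rw [interior_Ioo]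
    · exact fun x hx => (h₂ x hx).differentiableAt.differentiableWithinAt
    · exact fun x hx => (h₂ x hx).deriv ▸ hf₂ x hx
  have hconc : ConcaveOn ℝ (Ioo 0 4) f₁ := by
    refine concaveOn_of_hasDerivWithinAt2_nonpos (f' := f₂) (f'' := f₃) (convex_Ioo _ _) hf₁c
      ?_ ?_ ?_ <;> rw [interior_Ioo]
    · exact fun x hx => (h₂ x hx).hasDerivWithinAt
    · exact fun x hx => (h₃ x hx).hasDerivWithinAt
    · exact hf₃
  have hsub : Icc (2 : ℝ) 4 ⊆ Ioc 0 4 := fun x hx => ⟨by linarith [hx.1], hx.2⟩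
  have hsub' : Ioo (2 : ℝ) 4 ⊆ Ioo 0 4 := fun x hx => ⟨by linarith [hx.1], hx.2⟩
  set c := (f 4 - f 2 - 2 * f₁ 2) / 4 with hc
  -- The mean slope on `[2, 4]` is a value of the increasing `f₁` to the right of `2`.
  have hc0 : 0 ≤ c := by
    obtain ⟨η, hη, h⟩ := exists_hasDerivAt_eq_slope f f₁ (show (2 : ℝ) < 4 by norm_num)
      (hf.mono hsub) (fun x hx => h₁ x (hsub' hx))
    have := hmono hmem2 (hsub' hη) hη.1.le
    rw [h] at this
    rw [hc]; linarith
  refine ⟨c, hc0, by rw [hc]; ring, ?_⟩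
  set g : ℝ → ℝ := fun t => f t - (f 2 + f₁ 2 * (t - 2) + c * (t - 2) ^ 2) with hg
  set g' : ℝ → ℝ := fun t => f₁ t - (f₁ 2 + c * (2 * (t - 2))) with hg'
  have hgc : ContinuousOn g (Ioc 0 4) := by
    apply hf.sub; fun_prop
  have hgd : ∀ x ∈ Ioo (0 : ℝ) 4, HasDerivAt g (g' x) x := by
    intro x hx
    have e1 : HasDerivAt (fun t : ℝ => t - 2) 1 x := (hasDerivAt_id x).sub_const 2
    have := (h₁ x hx).sub (((e1.const_mul (f₁ 2)).const_add (f 2)).add ((e1.pow 2).const_mul c))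
    refine this.congr_deriv ?_
    simp only [hg']
    ring
  have hg2 : g 2 = 0 := by simp [hg]
  have hg4 : g 4 = 0 := by simp only [hg, hc]; ring
  have hg'2 : g' 2 = 0 := by simp [hg']
  have hg'conc : ConcaveOn ℝ (Ioo 0 4) g' := by
    refine ⟨convex_Ioo _ _, fun x hx y hy a b ha hb hab => ?_⟩
    have := hconc.2 hx hy ha hb hab
    simp only [smul_eq_mul] at this ⊢
    obtain rfl : b = 1 - a := by linarith
    linarith
  -- Rolle gives a second zero `ξ` of the concave `g'`, besides `2`. So `g'` is nonnegative between
  -- the zeros and nonpositive outside: `g` falls to `0` at `2`, rises up to `ξ`, then falls to `0`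
  -- at `4`.
  obtain ⟨ξ, hξ, hgξ⟩ := exists_hasDerivAt_eq_zero (f := g) (f' := g')
    (show (2 : ℝ) < 4 by norm_num) (hgc.mono hsub) (by rw [hg2, hg4])
    (fun x hx => hgd x (hsub' hx))
  have hξ' := hsub' hξ
  have s1 : ∀ x ∈ Ioo (0 : ℝ) 2, g' x ≤ 0 := by
    intro x hx
    have h := hg'conc.slope_anti_adjacent (⟨hx.1, by linarith [hx.2]⟩ : x ∈ Ioo (0 : ℝ) 4) hξ'
      hx.2 hξ.1
    rw [hgξ, hg'2, sub_zero, zero_div, le_div_iff₀ (by linarith [hx.2])] at h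
    linarith
  have s2 : ∀ x ∈ Ioo (2 : ℝ) ξ, 0 ≤ g' x := by
    intro x hx
    have h := hg'conc.slope_anti_adjacent hmem2 hξ' hx.1 hx.2
    rw [hgξ, hg'2, div_le_div_iff₀ (by linarith [hx.2]) (by linarith [hx.1])] at h
    by_contra! hneg
    nlinarith [mul_pos_of_neg_of_neg hneg (show 2 - ξ < 0 by linarith [hξ.1])]
  have s3 : ∀ x ∈ Ioo ξ 4, g' x ≤ 0 := by
    intro x hx
    have h := hg'conc.slope_anti_adjacent hmem2 (⟨by linarith [hx.1, hξ.1], hx.2⟩ :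
      x ∈ Ioo (0 : ℝ) 4) hξ.1 hx.1
    rw [hgξ, hg'2, sub_zero, sub_zero, zero_div, div_le_iff₀ (by linarith [hx.1])] at h
    linarith
  intro t ht
  suffices 0 ≤ g t by simp only [hg] at this; linarith
  rcases le_total t 2 with h | h
  · have : AntitoneOn g (Ioc 0 2) := by
      have hs : Ioo (0 : ℝ) 2 ⊆ Ioo 0 4 := Ioo_subset_Ioo le_rfl (by norm_num)
      refine antitoneOn_of_deriv_nonpos (convex_Ioc _ _)
        (hgc.mono (Ioc_subset_Ioc le_rfl (by norm_num))) ?_ ?_ <;> rw [interior_Ioc]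
      · exact fun x hx => (hgd x (hs hx)).differentiableAt.differentiableWithinAt
      · exact fun x hx => (hgd x (hs hx)).deriv ▸ s1 x hx
    rw [← hg2]
    exact this ⟨ht.1, h⟩ ⟨by norm_num, le_rfl⟩ h
  rcases le_total t ξ with h' | h'
  · have : MonotoneOn g (Icc 2 ξ) := by
      have hs : Ioo (2 : ℝ) ξ ⊆ Ioo 0 4 := Ioo_subset_Ioo (by norm_num) hξ.2.le
      refine monotoneOn_of_deriv_nonneg (convex_Icc _ _)
        (hgc.mono ((Icc_subset_Icc le_rfl hξ.2.le).trans hsub)) ?_ ?_ <;> rw [interior_Icc]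
      · exact fun x hx => (hgd x (hs hx)).differentiableAt.differentiableWithinAt
      · exact fun x hx => (hgd x (hs hx)).deriv ▸ s2 x hx
    rw [← hg2]
    exact this ⟨le_rfl, hξ.1.le⟩ ⟨h, h'⟩ h
  · have : AntitoneOn g (Icc ξ 4) := by
      have hs : Ioo ξ 4 ⊆ Ioo (0 : ℝ) 4 := Ioo_subset_Ioo hξ'.1.le le_rfl
      refine antitoneOn_of_deriv_nonpos (convex_Icc _ _)
        (hgc.mono ((Icc_subset_Icc hξ.1.le le_rfl).trans hsub)) ?_ ?_ <;> rw [interior_Icc]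
      · exact fun x hx => (hgd x (hs hx)).differentiableAt.differentiableWithinAt
      · exact fun x hx => (hgd x (hs hx)).deriv ▸ s3 x hx
    rw [← hg4]
    exact this ⟨h', ht.2⟩ ⟨hξ.2.le, le_rfl⟩ ht.2

lemma CompletelyMonotoneOn.exists_quadratic_minorant (hκ : CompletelyMonotoneOn κ (Ioc 0 4)) :
    ∃ a c, a ≤ 0 ∧ 0 ≤ c ∧ κ 2 + a * (4 - 2) + c * (4 - 2) ^ 2 = κ 4 ∧
      ∀ t ∈ Ioc (0 : ℝ) 4, κ 2 + a * (t - 2) + c * (t - 2) ^ 2 ≤ κ t := by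
  obtain ⟨hsm, hsign⟩ := hκ
  have hd : ∀ n, ∀ x ∈ Ioo (0 : ℝ) 4, HasDerivAt (iteratedDerivWithin n κ (Ioc 0 4))
      (iteratedDerivWithin (n + 1) κ (Ioc 0 4) x) x := by
    intro n x hx
    rw [iteratedDerivWithin_succ]
    have hdiff := hsm.differentiableOn_iteratedDerivWithin (m := n)
      (by exact_mod_cast WithTop.coe_lt_top n) (uniqueDiffOn_Ioc 0 4)
    exact (hdiff x ⟨hx.1, hx.2.le⟩).hasDerivWithinAt.hasDerivAt
      (Ioc_mem_nhds hx.1 hx.2)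
  have h0 := hd 0
  rw [iteratedDerivWithin_zero] at h0
  obtain ⟨c, hc, h4, h⟩ := KCL.exists_quadratic_minorant hsm.continuousOn h0 (hd 1) (hd 2)
    (fun x hx => by simpa using hsign 2 x ⟨hx.1, hx.2.le⟩)
    (fun x hx => by
      have := hsign 3 x ⟨hx.1, hx.2.le⟩
      norm_num at this
      simpa using this)
  refine ⟨_, c, ?_, hc, h4, h⟩
  have := hsign 1 2 ⟨by norm_num, by norm_num⟩
  norm_num at this
  simpa using this

end RealFunctions

end KCL
namespace KCL

open scoped InnerProductSpace

/-! ### Radial kernels on the sphere -/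

section Kernel

variable {d M : ℕ} {κ : ℝ → ℝ} {l : ℝ}

lemma UnitSphere.norm_eq (x : UnitSphere d) : ‖(x : EuclideanSpace ℝ (Fin d))‖ = 1 :=
  norm_eq_of_mem_sphere x

lemma UnitSphere.norm_sub_sq (x y : UnitSphere d) :
    ‖(x : EuclideanSpace ℝ (Fin d)) - y‖ ^ 2 =
      2 - 2 * ⟪(x : EuclideanSpace ℝ (Fin d)), y⟫_ℝ := by
  rw [norm_sub_sq_real, x.norm_eq, y.norm_eq]; ring

lemma UnitSphere.inner_self (x : UnitSphere d) :
    ⟪(x : EuclideanSpace ℝ (Fin d)), x⟫_ℝ = 1 := by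
  rw [real_inner_self_eq_norm_sq, x.norm_eq]; norm_num

lemma UnitSphere.norm_sub_sq_mem {x y : UnitSphere d} (h : x ≠ y) :
    ‖(x : EuclideanSpace ℝ (Fin d)) - y‖ ^ 2 ∈ Ioc (0 : ℝ) 4 := by
  have hne : (x : EuclideanSpace ℝ (Fin d)) - y ≠ 0 := sub_ne_zero.2 fun e => h (Subtype.ext e)
  refine ⟨by positivity, ?_⟩
  have h1 := norm_sub_le (x : EuclideanSpace ℝ (Fin d)) y
  rw [x.norm_eq, y.norm_eq] at h1
  nlinarith [norm_nonneg ((x : EuclideanSpace ℝ (Fin d)) - y)]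

lemma radialKernel_self (x : UnitSphere d) : radialKernel κ l x x = l := by
  simp [radialKernel]

lemma radialKernel_of_ne {x y : UnitSphere d} (h : x ≠ y) :
    radialKernel κ l x y = κ (2 - 2 * ⟪(x : EuclideanSpace ℝ (Fin d)), y⟫_ℝ) := by
  simp [radialKernel, h, UnitSphere.norm_sub_sq]

lemma radialKernel_comm (x y : UnitSphere d) :
    radialKernel κ l x y = radialKernel κ l y x := by
  rcases eq_or_ne x y with rfl | h
  · rfl
  · rw [radialKernel_of_ne h, radialKernel_of_ne h.symm, real_inner_comm]

lemma le_radialKernel {q : ℝ → ℝ} (hl : Tendsto κ (𝓝[>] 0) (𝓝 l)) (hq : ContinuousAt q 0)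
    (h : ∀ t ∈ Ioc (0 : ℝ) 4, q t ≤ κ t) (x y : UnitSphere d) :
    q (2 - 2 * ⟪(x : EuclideanSpace ℝ (Fin d)), y⟫_ℝ) ≤ radialKernel κ l x y := by
  rcases eq_or_ne x y with rfl | hne
  · rw [radialKernel_self, x.inner_self]
    norm_num
    exact le_limit_zero_of_le hl hq h
  · rw [radialKernel_of_ne hne]
    exact h _ (x.norm_sub_sq y ▸ UnitSphere.norm_sub_sq_mem hne)

lemma radialKernel_le (hκ : AntitoneOn κ (Ioc 0 4)) (hl : Tendsto κ (𝓝[>] 0) (𝓝 l))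
    (x y : UnitSphere d) : radialKernel κ l x y ≤ l := by
  rcases eq_or_ne x y with rfl | hne
  · rw [radialKernel_self]
  · rw [radialKernel_of_ne hne]
    exact hκ.le_limit_zero hl (x.norm_sub_sq y ▸ UnitSphere.norm_sub_sq_mem hne)

lemma radialKernel_lt (hκ : StrictAntiOn κ (Ioc 0 4)) (hl : Tendsto κ (𝓝[>] 0) (𝓝 l))
    {x y : UnitSphere d} (hne : x ≠ y) : radialKernel κ l x y < l := by
  rw [radialKernel_of_ne hne]
  exact hκ.lt_limit_zero hl (x.norm_sub_sq y ▸ UnitSphere.norm_sub_sq_mem hne)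

end Kernel

/-! ### Reduction of the loss to the pair energy -/

section Loss

variable {d M : ℕ} {κA : ℝ → ℝ} {lA : ℝ} {KU : UnitSphere d → UnitSphere d → ℝ} {γ B : ℝ}

/-- The sum of a kernel over the ordered pairs of distinct indices. -/
def pairSum (K : UnitSphere d → UnitSphere d → ℝ) (U : Fin M → UnitSphere d) : ℝ :=
  ∑ i, ∑ j ∈ Finset.univ.erase i, K (U i) (U j)

lemma kclSym_radialKernel (U V : Fin M → UnitSphere d) :
    kclSym (radialKernel κA lA) KU γ U V =
      -(1 / (M : ℝ)) * ∑ i, radialKernel κA lA (U i) (V i) +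
        γ * (1 / ((M : ℝ) * ((M : ℝ) - 1))) * (1 / 2 * (pairSum KU U + pairSum KU V)) := by
  have h : ∑ i, radialKernel κA lA (V i) (U i) = ∑ i, radialKernel κA lA (U i) (V i) :=
    Finset.sum_congr rfl fun i _ => radialKernel_comm _ _
  simp only [kclSym, kcl, h, pairSum]
  ring

lemma coeff_pos (hM : 1 < M) (hγ : 0 < γ) : 0 < γ * (1 / ((M : ℝ) * ((M : ℝ) - 1))) := by
  have : (1 : ℝ) < M := by exact_mod_cast hM
  have : (0 : ℝ) < (M : ℝ) - 1 := by linarith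
  positivity

/-- A diagonal pair whose pair sum is minimal is a global minimiser. -/
lemma mem_kclArgmin (hM : 1 < M) (hγ : 0 < γ) (hA : ∀ x y : UnitSphere d,
      radialKernel κA lA x y ≤ lA) (hB : ∀ U : Fin M → UnitSphere d, B ≤ pairSum KU U)
    {p : (Fin M → UnitSphere d) × (Fin M → UnitSphere d)} (hp : p.1 = p.2)
    (hpB : pairSum KU p.1 = B) : p ∈ kclArgmin (radialKernel κA lA) KU γ := by
  rintro ⟨U, V⟩ -
  simp only [mem_ofPred_eq, kclSym_radialKernel, ← hp, hpB, radialKernel_self]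
  have h1 : ∑ i, radialKernel κA lA (U i) (V i) ≤ ∑ _i : Fin M, lA :=
    Finset.sum_le_sum fun i _ => hA _ _
  have h2 : (1 / (M : ℝ)) * ∑ i, radialKernel κA lA (U i) (V i) ≤
      (1 / (M : ℝ)) * ∑ _i : Fin M, lA := mul_le_mul_of_nonneg_left h1 (by positivity)
  have h3 := mul_le_mul_of_nonneg_left
    (show 1 / 2 * (B + B) ≤ 1 / 2 * (pairSum KU U + pairSum KU V) by linarith [hB U, hB V])
    (coeff_pos hM hγ).le
  linarith

/-- If the minimal pair sum is attained and the alignment kernel is maximal only on the diagonal,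
then every global minimiser is a diagonal pair with minimal pair sum. -/
lemma eq_of_mem_kclArgmin (hM : 1 < M) (hγ : 0 < γ)
    (hA : ∀ x y : UnitSphere d, x ≠ y → radialKernel κA lA x y < lA)
    (hB : ∀ U : Fin M → UnitSphere d, B ≤ pairSum KU U) {U₀ : Fin M → UnitSphere d}
    (hU₀ : pairSum KU U₀ = B) {p : (Fin M → UnitSphere d) × (Fin M → UnitSphere d)}
    (hp : p ∈ kclArgmin (radialKernel κA lA) KU γ) : p.1 = p.2 ∧ pairSum KU p.1 = B := by
  have hle : kclSym (radialKernel κA lA) KU γ p.1 p.2 ≤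
    kclSym (radialKernel κA lA) KU γ U₀ U₀ := 
      isMinOn_univ_iff.1 (mem_ofPred_eq ▸ hp) (U₀, U₀)
  simp only [kclSym_radialKernel, hU₀, radialKernel_self] at hle
  have hA' : ∀ x y : UnitSphere d, radialKernel κA lA x y ≤ lA := fun x y => by
    rcases eq_or_ne x y with rfl | h
    · rw [radialKernel_self]
    · exact (hA x y h).le
  have h1 : ∑ i, radialKernel κA lA (p.1 i) (p.2 i) ≤ ∑ _i : Fin M, lA :=
    Finset.sum_le_sum fun i _ => hA' _ _
  have hMpos : 0 < 1 / (M : ℝ) := by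
    have : (0 : ℝ) < M := by exact_mod_cast (by omega : 0 < M)
    positivity
  have hc := coeff_pos hM hγ
  set c := γ * (1 / ((M : ℝ) * ((M : ℝ) - 1)))
  have h2 := mul_le_mul_of_nonneg_left h1 hMpos.le
  have hB1 := hB p.1
  have hB2 := hB p.2
  -- The alignment sum cannot exceed its diagonal value, so optimality against `(U₀, U₀)` leaves no
  -- room for excess pair energy.
  have h3 : c * (1 / 2 * (pairSum KU p.1 + pairSum KU p.2) - 1 / 2 * (B + B)) ≤ 0 := by linarith
  have h4 : 1 / 2 * (pairSum KU p.1 + pairSum KU p.2) - 1 / 2 * (B + B) ≤ 0 :=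
    nonpos_of_mul_nonpos_right h3 hc
  have h5 : pairSum KU p.1 = B := by linarith
  have h6 : pairSum KU p.2 = B := by linarith
  refine ⟨?_, h5⟩
  by_contra hne
  obtain ⟨i, hi⟩ := Function.ne_iff.1 hne
  have h7 : ∑ i, radialKernel κA lA (p.1 i) (p.2 i) < ∑ _i : Fin M, lA :=
    Finset.sum_lt_sum (fun i _ => hA' _ _) ⟨i, Finset.mem_univ _, hA _ _ hi⟩
  have h8 := mul_lt_mul_of_pos_left h7 hMpos
  rw [h5, h6] at hle
  linarith

end Loss

/-! ### Barycentre and frame potential -/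

section PairSums

variable {d M : ℕ} (U : Fin M → UnitSphere d)

lemma sum_sum_erase (f : Fin M → Fin M → ℝ) :
    ∑ i, ∑ j ∈ Finset.univ.erase i, f i j = ∑ i, ∑ j, f i j - ∑ i, f i i := by
  rw [← Finset.sum_sub_distrib]
  exact Finset.sum_congr rfl fun i _ => Finset.sum_erase_eq_sub (Finset.mem_univ i)

lemma sum_sum_erase_const (c : ℝ) :
    ∑ i : Fin M, ∑ _j ∈ Finset.univ.erase i, c = M * (M - 1) * c := by
  rw [sum_sum_erase fun _ _ => c]
  simp only [Finset.sum_const, Finset.card_univ, Fintype.card_fin, nsmul_eq_mul]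
  ring

lemma sum_sum_erase_inner :
    ∑ i, ∑ j ∈ Finset.univ.erase i, ⟪(U i : EuclideanSpace ℝ (Fin d)), U j⟫_ℝ =
      ‖∑ i, (U i : EuclideanSpace ℝ (Fin d))‖ ^ 2 - M := by
  rw [sum_sum_erase fun i j => ⟪(U i : EuclideanSpace ℝ (Fin d)), U j⟫_ℝ,
    ← real_inner_self_eq_norm_sq, sum_inner]
  simp only [inner_sum, UnitSphere.inner_self]
  simp

/-- The frame potential of `M` unit vectors of `ℝ^d` is at least `M² / d`. -/
lemma sq_le_mul_sum_inner_sq :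
    (M : ℝ) ^ 2 ≤ d * ∑ i, ∑ j, ⟪(U i : EuclideanSpace ℝ (Fin d)), U j⟫_ℝ ^ 2 := by
  -- The frame operator `∑ uᵢ uᵢᵀ`: its trace is `M`, its squared Hilbert–Schmidt norm is the frame
  -- potential, and Cauchy–Schwarz on the diagonal compares the two.
  set S : Fin d → Fin d → ℝ := fun k m =>
    ∑ i, (U i : EuclideanSpace ℝ (Fin d)) k * (U i : EuclideanSpace ℝ (Fin d)) m with hS
  have hin : ∀ i j, ⟪(U i : EuclideanSpace ℝ (Fin d)), U j⟫_ℝ =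
      ∑ k, (U i : EuclideanSpace ℝ (Fin d)) k * (U j : EuclideanSpace ℝ (Fin d)) k := by
    intro i j
    simp [PiLp.inner_apply, mul_comm]
  have htr : ∑ k, S k k = M := by
    simp only [hS]
    rw [Finset.sum_comm]
    simp only [← hin, UnitSphere.inner_self]
    simp
  have hsq : ∑ i, ∑ j, ⟪(U i : EuclideanSpace ℝ (Fin d)), U j⟫_ℝ ^ 2 =
      ∑ k, ∑ m, S k m ^ 2 := by
    simp only [hin, hS, sq, Finset.sum_mul_sum]
    have e1 : ∀ i : Fin M, ∑ j : Fin M, ∑ k : Fin d, ∑ m : Fin d,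
        (U i).1 k * (U j).1 k * ((U i).1 m * (U j).1 m) =
        ∑ k : Fin d, ∑ m : Fin d, ∑ j : Fin M,
        (U i).1 k * (U i).1 m * ((U j).1 k * (U j).1 m) := by
      intro i
      rw [Finset.sum_comm]
      refine Finset.sum_congr rfl fun k _ => ?_
      rw [Finset.sum_comm]
      refine Finset.sum_congr rfl fun m _ => Finset.sum_congr rfl fun j _ => by ring
    rw [Finset.sum_congr rfl fun i _ => e1 i, Finset.sum_comm]
    exact Finset.sum_congr rfl fun k _ => Finset.sum_comm
  have h1 : (∑ k, S k k) ^ 2 ≤ d * ∑ k, S k k ^ 2 := by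
    simpa using sq_sum_le_card_mul_sum_sq (s := (Finset.univ : Finset (Fin d)))
      (f := fun k => S k k)
  rw [htr] at h1
  refine h1.trans (mul_le_mul_of_nonneg_left ?_ (Nat.cast_nonneg d))
  rw [hsq]
  exact Finset.sum_le_sum fun k _ =>
    Finset.single_le_sum (f := fun m => S k m ^ 2) (fun m _ => sq_nonneg _) (Finset.mem_univ k)

end PairSums

/-! ### The regular simplex -/

section Simplex

variable {d M : ℕ} {U : Fin M → UnitSphere d}

/-- Unit vectors whose pairwise squared distances are all `2M / (M - 1)` are the vertices of a
regular simplex centred at the origin. -/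
lemma isCenteredRegularSimplex_of_inner (hM : 1 < M)
    (h : ∀ i j, i ≠ j → 2 - 2 * ⟪(U i : EuclideanSpace ℝ (Fin d)), U j⟫_ℝ =
      2 * M / ((M : ℝ) - 1)) : IsCenteredRegularSimplex U := by
  have hM' : (0 : ℝ) < (M : ℝ) - 1 := by
    have : (1 : ℝ) < M := by exact_mod_cast hM
    linarith
  have hin : ∀ i j, i ≠ j → ⟪(U i : EuclideanSpace ℝ (Fin d)), U j⟫_ℝ = -1 / ((M : ℝ) - 1) := by
    intro i j hij
    have := h i j hij
    field_simp at this ⊢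
    linarith
  have hsum : ∑ i, (U i : EuclideanSpace ℝ (Fin d)) = 0 := by
    have h1 := sum_sum_erase_inner U
    rw [Finset.sum_congr rfl fun i _ => Finset.sum_congr rfl fun j hj =>
      hin i j (Finset.ne_of_mem_erase hj).symm, sum_sum_erase_const] at h1
    have h2 : (M : ℝ) * (M - 1) * (-1 / (M - 1)) = -M := by field_simp
    rw [h2] at h1
    have h3 : ‖∑ i, (U i : EuclideanSpace ℝ (Fin d))‖ ^ 2 = 0 := by linarith
    simpa using h3
  refine ⟨?_, ⟨√(2 * M / ((M : ℝ) - 1)), fun i j hij => ?_⟩, hsum⟩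
  · rw [affineIndependent_iff]
    intro s w hw hs e he
    -- Pairing an affine relation with `U e` leaves `w e * M / (M - 1) = 0`, since the other weights
    -- sum to `-w e`.
    have h1 : ⟪∑ i ∈ s, w i • (U i : EuclideanSpace ℝ (Fin d)), U e⟫_ℝ = 0 := by
      rw [hs, inner_zero_left]
    simp only [sum_inner, real_inner_smul_left] at h1
    rw [← Finset.add_sum_erase _ _ he, UnitSphere.inner_self,
      Finset.sum_congr rfl fun i hi => by rw [hin i e (Finset.ne_of_mem_erase hi)],
      ← Finset.sum_mul] at h1
    rw [← Finset.add_sum_erase _ _ he] at hw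
    have h2 : ∑ i ∈ s.erase e, w i = -w e := by linarith
    rw [h2] at h1
    field_simp at h1
    have h3 : w e * M = 0 := by linarith
    have hM0 : (M : ℝ) ≠ 0 := by linarith
    exact (mul_eq_zero.1 h3).resolve_right hM0
  · rw [dist_eq_norm, ← h i j hij, ← UnitSphere.norm_sub_sq, Real.sqrt_sq (norm_nonneg _)]

/-- Expanding `‖∑ uᵢ‖² = 0` with a common inner product determines the edge length. -/
lemma IsCenteredRegularSimplex.sq_dist_eq (hU : IsCenteredRegularSimplex U) (hM : 1 < M)
    {i j : Fin M} (hij : i ≠ j) :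
    2 - 2 * ⟪(U i : EuclideanSpace ℝ (Fin d)), U j⟫_ℝ = 2 * M / ((M : ℝ) - 1) := by
  have hM1 : (1 : ℝ) < M := by exact_mod_cast hM
  have hM' : (0 : ℝ) < (M : ℝ) - 1 := by linarith
  obtain ⟨-, ⟨r, hr⟩, hsum⟩ := hU
  have h : ∀ i j, i ≠ j → ⟪(U i : EuclideanSpace ℝ (Fin d)), U j⟫_ℝ = 1 - r ^ 2 / 2 := by
    intro i j hij
    have h1 := UnitSphere.norm_sub_sq (U i) (U j)
    rw [← dist_eq_norm, hr i j hij] at h1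
    linarith
  have h1 := sum_sum_erase_inner U
  rw [Finset.sum_congr rfl fun i _ => Finset.sum_congr rfl fun j hj =>
      h i j (Finset.ne_of_mem_erase hj).symm, sum_sum_erase_const, hsum] at h1
  have h2 : (M : ℝ) * (((M : ℝ) - 1) * (1 - r ^ 2 / 2) + 1) = 0 := by
    simp at h1
    linarith
  have h3 := (mul_eq_zero.1 h2).resolve_left (by linarith)
  rw [h i j hij, eq_div_iff hM'.ne']
  linarith

lemma exists_linearIsometry_of_finrank_le {E : Type*} [NormedAddCommGroup E]
    [InnerProductSpace ℝ E] [FiniteDimensional ℝ E] (h : Module.finrank ℝ E ≤ d) :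
    Nonempty (E →ₗᵢ[ℝ] EuclideanSpace ℝ (Fin d)) := by
  let b := stdOrthonormalBasis ℝ E
  let v : Fin (Module.finrank ℝ E) → EuclideanSpace ℝ (Fin d) :=
    EuclideanSpace.basisFun (Fin d) ℝ ∘ Fin.castLE h
  have hv : Orthonormal ℝ v :=
    (EuclideanSpace.basisFun (Fin d) ℝ).orthonormal.comp _ (Fin.castLE_injective h)
  refine ⟨(b.toBasis.constr ℝ v).isometryOfOrthonormal (v := b.toBasis)
    (by simp [b.orthonormal]) ?_⟩
  convert hv
  ext i : 1
  exact b.toBasis.constr_basis ℝ v i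

/-- Project the standard basis of `ℝ^M` onto the hyperplane orthogonal to the all-ones vector,
normalise, and embed that hyperplane, of dimension `M - 1 ≤ d`, isometrically. -/
lemma exists_isCenteredRegularSimplex (hM : 1 < M) (hMd : M ≤ d + 1) :
    ∃ U : Fin M → UnitSphere d, IsCenteredRegularSimplex U := by
  have hM1 : (1 : ℝ) < M := by exact_mod_cast hM
  have hM' : (0 : ℝ) < (M : ℝ) - 1 := by linarith
  let o : EuclideanSpace ℝ (Fin M) := WithLp.toLp 2 fun _ => 1
  have hoo : ⟪o, o⟫_ℝ = M := by simp [o, PiLp.inner_apply, -inner_self_eq_norm_sq_to_K]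
  have ho : o ≠ 0 := by
    intro h
    rw [h, inner_zero_left] at hoo
    linarith
  let e : Fin M → EuclideanSpace ℝ (Fin M) := fun i => EuclideanSpace.single i 1
  have hoe : ∀ i, ⟪o, e i⟫_ℝ = 1 := by intro i; simp [o, e, EuclideanSpace.inner_single_right]
  have hee : ∀ i j, ⟪e i, e j⟫_ℝ = if i = j then 1 else 0 := by
    intro i j
    simp [e, EuclideanSpace.inner_single_left]
  -- The projected basis vectors have squared norm `(M - 1) / M`.
  let c : ℝ := √(M / (M - 1))
  have hc : c ^ 2 = M / (M - 1) := Real.sq_sqrt (by positivity)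
  let w : Fin M → EuclideanSpace ℝ (Fin M) := fun i => c • (e i - (1 / (M : ℝ)) • o)
  have hww : ∀ i j, ⟪w i, w j⟫_ℝ = M / (M - 1) * ((if i = j then 1 else 0) - 1 / M) := by
    intro i j
    simp only [w, real_inner_smul_left, real_inner_smul_right, inner_sub_left, inner_sub_right,
      hee, hoe, hoo, real_inner_comm o (e i)]
    rw [← hc]
    field_simp
    ring
  have hmem : ∀ i, w i ∈ (ℝ ∙ o)ᗮ := by
    intro i
    rw [Submodule.mem_orthogonal_singleton_iff_inner_right]
    simp only [w, real_inner_smul_right, inner_sub_right, hoe, hoo]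
    field_simp
    simp
  have hfin : Module.finrank ℝ (ℝ ∙ o)ᗮ ≤ d := by
    have : Fact (Module.finrank ℝ (EuclideanSpace ℝ (Fin M)) = (M - 1) + 1) :=
      ⟨by simp; omega⟩
    rw [Submodule.finrank_orthogonal_span_singleton (n := M - 1) ho]
    omega
  obtain ⟨T⟩ := exists_linearIsometry_of_finrank_le hfin
  have hT : ∀ i j, ⟪T ⟨w i, hmem i⟩, T ⟨w j, hmem j⟩⟫_ℝ =
      M / (M - 1) * ((if i = j then 1 else 0) - 1 / M) := by
    intro i j
    rw [T.inner_map_map, Submodule.coe_inner, hww]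
  refine ⟨fun i => ⟨T ⟨w i, hmem i⟩, ?_⟩, isCenteredRegularSimplex_of_inner hM ?_⟩
  · rw [mem_sphere_zero_iff_norm, ← sq_eq_sq₀ (norm_nonneg _) zero_le_one,
      ← real_inner_self_eq_norm_sq, hT, if_pos rfl]
    field_simp
  · intro i j hij
    simp only [hT, if_neg hij]
    field_simp
    ring

variable {κ : ℝ → ℝ} {l : ℝ}

lemma simplex_sq_dist_mem (hM : 1 < M) : 2 * M / ((M : ℝ) - 1) ∈ Ioc (0 : ℝ) 4 := by
  have hM1 : (2 : ℝ) ≤ M := by exact_mod_cast hM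
  have hM' : (0 : ℝ) < (M : ℝ) - 1 := by linarith
  refine ⟨by positivity, ?_⟩
  rw [div_le_iff₀ hM']
  linarith

lemma IsCenteredRegularSimplex.pairSum_eq (hU : IsCenteredRegularSimplex U) (hM : 1 < M) :
    pairSum (radialKernel κ l) U = M * (M - 1) * κ (2 * M / ((M : ℝ) - 1)) := by
  rw [pairSum, ← sum_sum_erase_const]
  refine Finset.sum_congr rfl fun i _ => Finset.sum_congr rfl fun j hj => ?_
  have hij := (Finset.ne_of_mem_erase hj).symm
  rw [radialKernel_of_ne, hU.sq_dist_eq hM hij]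
  intro h
  have h1 := hU.sq_dist_eq hM hij
  rw [h, UnitSphere.inner_self] at h1
  linarith [(simplex_sq_dist_mem hM).1]

lemma simplex_le_sum_supporting_line (hM : 1 < M) {s : ℝ} (hs : s ≤ 0)
    (U : Fin M → UnitSphere d) :
    M * (M - 1) * κ (2 * M / ((M : ℝ) - 1)) ≤
      ∑ i, ∑ j ∈ Finset.univ.erase i, (κ (2 * M / ((M : ℝ) - 1)) +
        s * (2 - 2 * ⟪(U i : EuclideanSpace ℝ (Fin d)), U j⟫_ℝ - 2 * M / ((M : ℝ) - 1))) := by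
  have hM1 : (1 : ℝ) < M := by exact_mod_cast hM
  have hM' : (0 : ℝ) < (M : ℝ) - 1 := by linarith
  have h1 : ∀ i j, κ (2 * M / ((M : ℝ) - 1)) +
        s * (2 - 2 * ⟪(U i : EuclideanSpace ℝ (Fin d)), U j⟫_ℝ - 2 * M / ((M : ℝ) - 1)) =
      (κ (2 * M / ((M : ℝ) - 1)) + s * (2 - 2 * M / ((M : ℝ) - 1))) +
        -2 * s * ⟪(U i : EuclideanSpace ℝ (Fin d)), U j⟫_ℝ := by intro i j; ring
  simp only [h1, Finset.sum_add_distrib, ← Finset.mul_sum, sum_sum_erase_inner]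
  rw [sum_sum_erase_const, sum_sum_erase_const]
  have h2 : (M : ℝ) * (M - 1) * (2 - 2 * M / ((M : ℝ) - 1)) = -2 * M := by
    field_simp
    ring
  have h3 : 0 ≤ -2 * s * ‖∑ i, (U i : EuclideanSpace ℝ (Fin d))‖ ^ 2 :=
    mul_nonneg (by linarith) (sq_nonneg _)
  linear_combination h3 - s * h2

lemma simplex_le_pairSum (hM : 1 < M) (hl : Tendsto κ (𝓝[>] 0) (𝓝 l))
    (hκ : AntitoneOn κ (Ioc 0 4)) (hc : ConvexOn ℝ (Ioc 0 4) κ) (U : Fin M → UnitSphere d) :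
    M * (M - 1) * κ (2 * M / ((M : ℝ) - 1)) ≤ pairSum (radialKernel κ l) U := by
  obtain ⟨s, hs, h⟩ := exists_supporting_line hκ hc (simplex_sq_dist_mem hM)
  refine (simplex_le_sum_supporting_line hM hs U).trans ?_
  exact Finset.sum_le_sum fun i _ => Finset.sum_le_sum fun j _ =>
    le_radialKernel (q := fun t => κ (2 * M / ((M : ℝ) - 1)) + s * (t - 2 * M / ((M : ℝ) - 1)))
      hl (by fun_prop) h _ _

lemma isCenteredRegularSimplex_of_pairSum_eq (hM : 1 < M) (hl : Tendsto κ (𝓝[>] 0) (𝓝 l))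
    (hκ : AntitoneOn κ (Ioc 0 4)) (hc : StrictConvexOn ℝ (Ioc 0 4) κ)
    (hU : pairSum (radialKernel κ l) U = M * (M - 1) * κ (2 * M / ((M : ℝ) - 1))) :
    IsCenteredRegularSimplex U := by
  have ht := simplex_sq_dist_mem hM
  obtain ⟨s, hs, h⟩ := exists_supporting_line hκ hc.convexOn ht
  refine isCenteredRegularSimplex_of_inner hM fun i j hij => ?_
  by_contra hne
  have hle : ∀ i j, κ (2 * M / ((M : ℝ) - 1)) +
      s * (2 - 2 * ⟪(U i : EuclideanSpace ℝ (Fin d)), U j⟫_ℝ - 2 * M / ((M : ℝ) - 1)) ≤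
      radialKernel κ l (U i) (U j) := fun i j =>
    le_radialKernel (q := fun t => κ (2 * M / ((M : ℝ) - 1)) + s * (t - 2 * M / ((M : ℝ) - 1)))
      hl (by fun_prop) h _ _
  have hlt : κ (2 * M / ((M : ℝ) - 1)) +
      s * (2 - 2 * ⟪(U i : EuclideanSpace ℝ (Fin d)), U j⟫_ℝ - 2 * M / ((M : ℝ) - 1)) <
      radialKernel κ l (U i) (U j) := by
    -- Coinciding points also violate the prescribed distance; there the strict bound is the one on
    -- the limit at `0`.
    rcases eq_or_ne (U i) (U j) with heq | hUne
    · rw [heq, radialKernel_self, UnitSphere.inner_self, mul_one, sub_self]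
      exact supporting_line_lt_limit hκ hc hl ht h
    · rw [radialKernel_of_ne hUne]
      exact supporting_line_lt hc ht h
        ((U i).norm_sub_sq (U j) ▸ UnitSphere.norm_sub_sq_mem hUne) hne
  have := simplex_le_sum_supporting_line (κ := κ) hM hs U
  rw [← hU, pairSum] at this
  refine this.not_gt (Finset.sum_lt_sum (fun i _ => Finset.sum_le_sum fun j _ => hle i j)
    ⟨i, Finset.mem_univ i, Finset.sum_lt_sum (fun j _ => hle i j)
      ⟨j, Finset.mem_erase.2 ⟨hij.symm, Finset.mem_univ j⟩, hlt⟩⟩)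

end Simplex

/-! ### The cross-polytope -/

section CrossPolytope

variable {d : ℕ} {κ : ℝ → ℝ} {l : ℝ}

lemma exists_isCrossPolytope : ∃ U : Fin (2 * d) → UnitSphere d, IsCrossPolytope U := by
  let e := EuclideanSpace.basisFun (Fin d) ℝ
  let σ : Fin d ⊕ Fin d ≃ Fin (2 * d) := finSumFinEquiv.trans (finCongr (two_mul d).symm)
  refine ⟨fun i => Sum.elim (fun k => ⟨e k, by simp [e]⟩) (fun k => ⟨-e k, by simp [e]⟩)
    (σ.symm i), e, σ, fun k => by simp⟩

variable {U : Fin (2 * d) → UnitSphere d}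

lemma IsCrossPolytope.sum_eq_zero (hU : IsCrossPolytope U) :
    ∑ i, (U i : EuclideanSpace ℝ (Fin d)) = 0 := by
  obtain ⟨e, σ, h⟩ := hU
  rw [← σ.sum_comp, Fintype.sum_sum_type]
  simp [h]

/-- Parseval, with every axis counted twice: the cross-polytope is a tight frame. -/
lemma IsCrossPolytope.sum_inner_sq (hU : IsCrossPolytope U) (x : UnitSphere d) :
    ∑ j, ⟪(x : EuclideanSpace ℝ (Fin d)), U j⟫_ℝ ^ 2 = 2 := by
  obtain ⟨e, σ, h⟩ := hU
  rw [← σ.sum_comp, Fintype.sum_sum_type]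
  simp only [h, inner_neg_right, neg_sq]
  have := e.sum_sq_inner_right (x : EuclideanSpace ℝ (Fin d))
  rw [x.norm_eq] at this
  simp only [real_inner_comm] at this ⊢
  linarith

lemma IsCrossPolytope.inner_eq (hU : IsCrossPolytope U) {i j : Fin (2 * d)} (hij : i ≠ j) :
    ⟪(U i : EuclideanSpace ℝ (Fin d)), U j⟫_ℝ = 0 ∨
      ⟪(U i : EuclideanSpace ℝ (Fin d)), U j⟫_ℝ = -1 := by
  obtain ⟨e, σ, h⟩ := hU
  obtain ⟨a, rfl⟩ := σ.surjective i
  obtain ⟨b, rfl⟩ := σ.surjective j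
  have hab : a ≠ b := fun h => hij (h ▸ rfl)
  rcases a with a | a <;> rcases b with b | b <;>
    simp only [h, inner_neg_left, inner_neg_right, e.inner_eq_ite] <;> split_ifs <;> simp_all

/-- The sum of a quadratic in the squared distances, expanded in inner products. -/
lemma sum_sum_erase_quadratic {M : ℕ} (U : Fin M → UnitSphere d) (b a c : ℝ) :
    ∑ i, ∑ j ∈ Finset.univ.erase i,
      (b + a * (2 - 2 * ⟪(U i : EuclideanSpace ℝ (Fin d)), U j⟫_ℝ - 2) +
        c * (2 - 2 * ⟪(U i : EuclideanSpace ℝ (Fin d)), U j⟫_ℝ - 2) ^ 2) =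
      M * (M - 1) * b - 2 * a * (‖∑ i, (U i : EuclideanSpace ℝ (Fin d))‖ ^ 2 - M) +
        4 * c * (∑ i, ∑ j, ⟪(U i : EuclideanSpace ℝ (Fin d)), U j⟫_ℝ ^ 2 - M) := by
  have h1 : ∀ i j, b + a * (2 - 2 * ⟪(U i : EuclideanSpace ℝ (Fin d)), U j⟫_ℝ - 2) +
        c * (2 - 2 * ⟪(U i : EuclideanSpace ℝ (Fin d)), U j⟫_ℝ - 2) ^ 2 =
      b + -(2 * a) * ⟪(U i : EuclideanSpace ℝ (Fin d)), U j⟫_ℝ +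
        4 * c * ⟪(U i : EuclideanSpace ℝ (Fin d)), U j⟫_ℝ ^ 2 := by intro i j; ring
  have h2 := sum_sum_erase fun i j => ⟪(U i : EuclideanSpace ℝ (Fin d)), U j⟫_ℝ ^ 2
  simp only [UnitSphere.inner_self] at h2
  have h3 := sum_sum_erase_const (M := M) b
  simp only [h1, Finset.sum_add_distrib, ← Finset.mul_sum, sum_sum_erase_inner, h2, h3]
  simp
  ring

lemma crossPolytope_le_sum_quadratic (hd : 1 ≤ d) {b a c : ℝ} (ha : a ≤ 0) (hc : 0 ≤ c)
    {V : Fin (2 * d) → UnitSphere d} (hV : IsCrossPolytope V) (U : Fin (2 * d) → UnitSphere d) :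
    ∑ i, ∑ j ∈ Finset.univ.erase i,
      (b + a * (2 - 2 * ⟪(V i : EuclideanSpace ℝ (Fin d)), V j⟫_ℝ - 2) +
        c * (2 - 2 * ⟪(V i : EuclideanSpace ℝ (Fin d)), V j⟫_ℝ - 2) ^ 2) ≤
    ∑ i, ∑ j ∈ Finset.univ.erase i,
      (b + a * (2 - 2 * ⟪(U i : EuclideanSpace ℝ (Fin d)), U j⟫_ℝ - 2) +
        c * (2 - 2 * ⟪(U i : EuclideanSpace ℝ (Fin d)), U j⟫_ℝ - 2) ^ 2) := by
  rw [sum_sum_erase_quadratic, sum_sum_erase_quadratic, hV.sum_eq_zero]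
  simp only [hV.sum_inner_sq]
  have hd' : (0 : ℝ) < d := by exact_mod_cast hd
  have h1 := sq_le_mul_sum_inner_sq U
  -- The frame bound `M² / d` at `M = 2d`, which the cross-polytope attains.
  have h2 : 4 * (d : ℝ) ≤ ∑ i, ∑ j, ⟪(U i : EuclideanSpace ℝ (Fin d)), U j⟫_ℝ ^ 2 := by
    refine le_of_mul_le_mul_left ?_ hd'
    refine le_trans (le_of_eq ?_) h1
    push_cast
    ring
  have h3 := mul_le_mul_of_nonneg_left h2 hc
  have h4 : 0 ≤ -a * ‖∑ i, (U i : EuclideanSpace ℝ (Fin d))‖ ^ 2 :=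
    mul_nonneg (by linarith) (sq_nonneg _)
  simp only [Finset.sum_const, Finset.card_univ, Fintype.card_fin, nsmul_eq_mul, norm_zero]
  push_cast
  linarith

/-- The minorant equals `κ` at `2` and `4`, the only squared distances in `V`, so the quadratic
bound is sharp at `V`. -/
lemma crossPolytope_pairSum_le (hd : 1 ≤ d) (hl : Tendsto κ (𝓝[>] 0) (𝓝 l))
    (hκ : CompletelyMonotoneOn κ (Ioc 0 4)) {V : Fin (2 * d) → UnitSphere d}
    (hV : IsCrossPolytope V) (U : Fin (2 * d) → UnitSphere d) :
    pairSum (radialKernel κ l) V ≤ pairSum (radialKernel κ l) U := by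
  obtain ⟨a, c, ha, hc, h4, h⟩ := hκ.exists_quadratic_minorant
  refine le_trans (le_of_eq ?_) ((crossPolytope_le_sum_quadratic (b := κ 2) hd ha hc hV U).trans ?_)
  · refine Finset.sum_congr rfl fun i _ => Finset.sum_congr rfl fun j hj => ?_
    have hin := hV.inner_eq (Finset.ne_of_mem_erase hj).symm
    have hne : V i ≠ V j := by
      intro heq
      rw [heq, UnitSphere.inner_self] at hin
      norm_num at hin
    rw [radialKernel_of_ne hne]
    rcases hin with hin | hin <;> rw [hin]
    · norm_num
    · norm_num at h4 ⊢
      exact h4.symm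
  · exact Finset.sum_le_sum fun i _ => Finset.sum_le_sum fun j _ =>
      le_radialKernel (q := fun t => κ 2 + a * (t - 2) + c * (t - 2) ^ 2) hl (by fun_prop) h _ _

end CrossPolytope

end KCL

theorem theorem3 (d M : ℕ) (hd : 1 ≤ d) (γ : ℝ) (hγ : 0 < γ)
    (κA κU : ℝ → ℝ) (lA lU : ℝ)
    (hlA : Tendsto κA (𝓝[>] 0) (𝓝 lA)) (hlU : Tendsto κU (𝓝[>] 0) (𝓝 lU)) :
    (1 < M → M ≤ d + 1 →
      (∃ U : Fin M → KCL.UnitSphere d, KCL.IsCenteredRegularSimplex U) ∧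
      (AntitoneOn κA (Ioc 0 4) → AntitoneOn κU (Ioc 0 4) → ConvexOn ℝ (Ioc 0 4) κU →
        {p : (Fin M → KCL.UnitSphere d) × (Fin M → KCL.UnitSphere d) |
            p.1 = p.2 ∧ KCL.IsCenteredRegularSimplex p.1} ⊆
          KCL.kclArgmin (KCL.radialKernel κA lA) (KCL.radialKernel κU lU) γ) ∧
      (StrictAntiOn κA (Ioc 0 4) → StrictAntiOn κU (Ioc 0 4) →
        StrictConvexOn ℝ (Ioc 0 4) κU →
        KCL.kclArgmin (KCL.radialKernel κA lA) (KCL.radialKernel κU lU) γ =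
          {p : (Fin M → KCL.UnitSphere d) × (Fin M → KCL.UnitSphere d) |
            p.1 = p.2 ∧ KCL.IsCenteredRegularSimplex p.1})) ∧
    (M = 2 * d →
      (∃ U : Fin M → KCL.UnitSphere d, KCL.IsCrossPolytope U) ∧
      (AntitoneOn κA (Ioc 0 4) → KCL.CompletelyMonotoneOn κU (Ioc 0 4) →
        {p : (Fin M → KCL.UnitSphere d) × (Fin M → KCL.UnitSphere d) |
            p.1 = p.2 ∧ KCL.IsCrossPolytope p.1} ⊆
          KCL.kclArgmin (KCL.radialKernel κA lA) (KCL.radialKernel κU lU) γ)) := by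
  constructor
  · intro hM hMd
    obtain ⟨U₀, hU₀⟩ := KCL.exists_isCenteredRegularSimplex hM hMd
    refine ⟨⟨U₀, hU₀⟩, ?_, ?_⟩
    · rintro hA hU hc p ⟨hp, hs⟩
      exact KCL.mem_kclArgmin hM hγ (KCL.radialKernel_le hA hlA)
        (KCL.simplex_le_pairSum hM hlU hU hc) hp (hs.pairSum_eq hM)
    · intro hA hU hc
      have hB := KCL.simplex_le_pairSum (d := d) hM hlU hU.antitoneOn hc.convexOn
      refine Subset.antisymm (fun p hp => ?_) ?_
      · obtain ⟨h1, h2⟩ := KCL.eq_of_mem_kclArgmin hM hγ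
          (fun x y h => KCL.radialKernel_lt hA hlA h) hB (hU₀.pairSum_eq hM) hp
        exact ⟨h1, KCL.isCenteredRegularSimplex_of_pairSum_eq hM hlU hU.antitoneOn hc h2⟩
      · rintro p ⟨hp, hs⟩
        exact KCL.mem_kclArgmin hM hγ (KCL.radialKernel_le hA.antitoneOn hlA) hB hp
          (hs.pairSum_eq hM)
  · rintro rfl
    refine ⟨KCL.exists_isCrossPolytope, ?_⟩
    rintro hA hU p ⟨hp, hs⟩
    -- The lower bound is the pair sum of `p.1` itself, so it is attained by `rfl`.
    exact KCL.mem_kclArgmin (by omega) hγ (KCL.radialKernel_le hA hlA)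
      (KCL.crossPolytope_pairSum_le hd hlU hU hs) hp rfl
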